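/- Let $P$ be a probability distribution of pairs (feature vector, label) on $\mathcal{X}\times\mathcal{Y}$ and let $s:\mathcal{X}\times\mathcal{Y}\to\mathbb{R}$ be a measurable conformal score. Let $m\ge 1$, let $\mathcal{D}_{\mathrm{cal}}=((X_i,Y_i))_{i=1}^m$ be a calibration set of independent samples from $P$, and let $(X,Y)\sim P$ be a new sample independent of $\mathcal{D}_{\mathrm{cal}}$. For $\alpha\in[0,1]$ let $\hat q_\alpha$ be the $\frac{\lceil (m+1)(1-\alpha)\rceil}{m}$ empirical quantile of the calibration scores $s(X_1,Y_1),\dots,s(X_m,Y_m)$; here the empirical quantile of level $p$ is $$\inf\Big\{t\in[-\infty,\infty] : \tfrac1m\,\#\{i : s(X_i,Y_i)\le t\}\ge p\Big\},\qquad \inf\emptyset=+\infty,$$ so that $\hat q_\alpha$ is the $k$-th smallest calibration score, $k=\lceil (m+1)(1-\alpha)\rceil$, if $1\le k\le m$, while $\hat q_\alpha=-\infty$ if $k=0$ and $\hat q_\alpha=+\infty$ if $k=m+1$. For $0\le\alpha_1<\alpha_2\le 1$ let $$\mathcal{C}_{\alpha_1,\alpha_2}(x)=\{y\in\mathcal{Y}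 : \hat q_{\alpha_2}<s(x,y)\le \hat q_{\alpha_1}\}.$$ Assume that the calibration scores $s(X_1,Y_1),\dots,s(X_m,Y_m)$ are almost surely pairwise distinct (for $m=1$, where this says nothing, assume instead that the distribution of $s(X,Y)$ has no atoms). Then the random variable $\mathbb{P}[Y\in\mathcal{C}_{\alpha_1,\alpha_2}(X)\mid\mathcal{D}_{\mathrm{cal}}]$ satisfies $$\mathbb{P}[Y\in\mathcal{C}_{\alpha_1,\alpha_2}(X)\mid\mathcal{D}_{\mathrm{cal}}]\sim\mathrm{Beta}(l,\,m-l+1),\qquad l=\lceil(m+1)(1-\alpha_1)\rceil-\lceil(m+1)(1-\alpha_2)\rceil,$$ where, in the degenerate cases $l=0$ and $l=m+1$, $\mathrm{Beta}(0,m+1)$ denotes the unit mass at $0$ and $\mathrm{Beta}(m+1,0)$ the unit mass at $1$. -/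

import Mathlib

open MeasureTheory ProbabilityTheory

noncomputable section

/-- The empirical quantile of level `p` of the numbers `v 0, …, v (m - 1)`: the generalized inverse
`inf {t : p ≤ F t}` of their empirical distribution function `F t = #{i | v i ≤ t} / m`, the infimum
being taken in the extended reals. For `1 ≤ k ≤ m` the quantile of level `k / m` is the `k`-th
smallest of the numbers, the quantile of level `0` is `-∞`, and a level above `1` gives `+∞`. -/
def empiricalQuantile {m : ℕ} (v : Fin m → ℝ) (p : ℝ) : EReal :=
  sInf {t : EReal | p ≤ (Nat.card {i : Fin m // (v i : EReal) ≤ t} : ℝ) / (m : ℝ)}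

/-- The threshold `q̂_α`: the empirical quantile of level `⌈(m + 1) (1 - α)⌉ / m` of the `m`
calibration scores `v`. -/
def conformalThreshold {m : ℕ} (v : Fin m → ℝ) (α : ℝ) : EReal :=
  empiricalQuantile v ((⌈((m : ℝ) + 1) * (1 - α)⌉ : ℝ) / (m : ℝ))

/-- The two-threshold prediction set `{y | q̂_{α₂} < s(x, y) ≤ q̂_{α₁}}` built from the conformal
score `s` and the calibration scores `v`. -/
def twoThresholdSet {𝒳 𝒴 : Type*} {m : ℕ} (s : 𝒳 → 𝒴 → ℝ) (v : Fin m → ℝ) (α₁ α₂ : ℝ)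
    (x : 𝒳) : Set 𝒴 :=
  {y | conformalThreshold v α₂ < (s x y : EReal) ∧ (s x y : EReal) ≤ conformalThreshold v α₁}

/-- The law `Beta(a, b)` on the real line, with the usual (limiting) convention for a vanishing
parameter: `Beta(0, b)` is the unit mass at `0` and `Beta(a, 0)` is the unit mass at `1`. -/
def betaLaw (a b : ℝ) : Measure ℝ :=
  if a = 0 then Measure.dirac 0 else if b = 0 then Measure.dirac 1 else betaMeasure a b

end

/-! Given the calibration data, the new score is an independent draw from the score law ν, so the
conditional probability is the ν-mass between two order statistics of the calibration scores. Two
independent scores almost surely differ, so ν has no atoms (for m = 1 this is assumed). Its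
distribution function then turns the scores into independent uniforms and, being monotone, respects
order statistics. The conditional probability becomes U_(b) - U_(a), with U_(0) = 0 and U_(m+1) = 1
(`measureReal_le_empiricalQuantile`, `map_cdf_eq_uniform`).

The law of this difference depends only on l = b - a: a volume-preserving rotation of the spacings
shifts both indices by one (`map_orderStat_sub_succ`), which reduces to a = 0 and leaves U_(l). For
0 ≤ x < 1, U_(l) ≤ x says that at least l uniforms are at most x; this binomial tail is a sum of
Bernstein polynomials whose derivative telescopes to the Beta density (`betaMeasure_Iic`). -/

/-! ### Empirical quantiles and order statistics -/

open Finset in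
/-- Among `m` real numbers there is a `k`-th smallest one for every `1 ≤ k ≤ m`. -/
lemma exists_kth_smallest {m : ℕ} (v : Fin m → ℝ) {k : ℕ} (hk : k ≠ 0) (hkm : k ≤ m) :
    ∃ j, k ≤ #{i | v i ≤ v j} ∧ #{i | v i < v j} < k := by
  have : Nonempty (Fin m) := ⟨⟨0, by omega⟩⟩
  obtain ⟨a, -, ha⟩ := exists_max_image univ v univ_nonempty
  have hne : (univ.filter fun j => k ≤ #{i | v i ≤ v j}).Nonempty := by
    refine ⟨a, ?_⟩
    have : ({i | v i ≤ v a} : Finset (Fin m)) = univ := by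
      ext i; simpa using ha i (mem_univ i)
    simp [this, hkm]
  obtain ⟨j, hj, hjmin⟩ := exists_min_image _ v hne
  refine ⟨j, by simpa using hj, ?_⟩
  by_contra! hcon
  have hne' : ({i | v i < v j} : Finset (Fin m)).Nonempty := by
    rw [← card_pos]; omega
  obtain ⟨b, hb, hbmax⟩ := exists_max_image _ v hne'
  have hb' : v b < v j := by simpa using hb
  refine absurd (hjmin b ?_) (not_le.2 hb')
  have : #{i | v i < v j} ≤ #{i | v i ≤ v b} :=
    card_le_card fun i hi => by simpa using hbmax i hi
  simpa using hcon.trans this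

open Finset in
lemma empiricalQuantile_set {m : ℕ} (hm : 0 < m) (v : Fin m → ℝ) (k : ℕ) :
    {t : EReal | (k : ℝ) / m ≤ (Nat.card {i : Fin m // (v i : EReal) ≤ t} : ℝ) / (m : ℝ)} =
      {t : EReal | k ≤ #{i | (v i : EReal) ≤ t}} := by
  ext t
  have hm' : (0 : ℝ) < m := by exact_mod_cast hm
  rw [Set.mem_ofPred_eq, div_le_div_iff_of_pos_right hm', Nat.card_eq_fintype_card,
    Fintype.card_subtype, Nat.cast_le, Set.mem_ofPred_eq]

lemma empiricalQuantile_zero {m : ℕ} (v : Fin m → ℝ) :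
    empiricalQuantile v (((0 : ℕ) : ℝ) / m) = ⊥ := by
  have : {t : EReal | (((0 : ℕ) : ℝ) / m) ≤
      (Nat.card {i : Fin m // (v i : EReal) ≤ t} : ℝ) / (m : ℝ)} = Set.univ := by
    ext t
    simp only [Nat.cast_zero, zero_div, Set.mem_ofPred_eq, Set.mem_univ, iff_true]
    positivity
  rw [empiricalQuantile, this, sInf_univ]

open Finset in
lemma empiricalQuantile_of_lt {m : ℕ} (hm : 0 < m) (v : Fin m → ℝ) {k : ℕ} (hk : m < k) :
    empiricalQuantile v ((k : ℝ) / m) = ⊤ := by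
  rw [empiricalQuantile, empiricalQuantile_set hm]
  have : {t : EReal | k ≤ #{i | (v i : EReal) ≤ t}} = ∅ := by
    ext t
    have := card_le_univ ({i | (v i : EReal) ≤ t} : Finset (Fin m))
    simp only [Fintype.card_fin] at this
    simp only [Set.mem_ofPred_eq, Set.mem_empty_iff_false, iff_false]
    omega
  rw [this, sInf_empty]

-- The two counts single out the k-th smallest value even when there are ties, so distinctness is
-- never needed for quantiles.
open Finset in
lemma empiricalQuantile_eq_coe {m : ℕ} (hm : 0 < m) (v : Fin m → ℝ) {k : ℕ} {y : ℝ}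
    (h₁ : k ≤ #{i | v i ≤ y}) (h₂ : #{i | v i < y} < k) :
    empiricalQuantile v ((k : ℝ) / m) = y := by
  rw [empiricalQuantile, empiricalQuantile_set hm]
  refine IsLeast.csInf_eq ⟨by simpa using h₁, fun t ht => ?_⟩
  by_contra! hlt
  have : #{i | (v i : EReal) ≤ t} ≤ #{i | v i < y} := card_le_card fun i hi => by
    simpa using EReal.coe_lt_coe_iff.1 (lt_of_le_of_lt (by simpa using hi) hlt)
  exact absurd this (not_le.2 (h₂.trans_le ht))

/-- The order statistics of `u`, extended by `0` at the index `0` and by `1` beyond `m`. -/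
noncomputable def orderStat {m : ℕ} (u : Fin m → ℝ) (k : ℕ) : ℝ :=
  if k = 0 then 0 else if m < k then 1 else (empiricalQuantile u ((k : ℝ) / m)).toReal

@[simp] lemma orderStat_zero {m : ℕ} (u : Fin m → ℝ) : orderStat u 0 = 0 := by simp [orderStat]

lemma orderStat_of_lt {m : ℕ} (u : Fin m → ℝ) {k : ℕ} (hk : m < k) : orderStat u k = 1 := by
  simp [orderStat, hk, show k ≠ 0 by omega]

open Finset in
lemma orderStat_eq {m : ℕ} (hm : 0 < m) (u : Fin m → ℝ) {k : ℕ} (hk : k ≠ 0) (hkm : k ≤ m) {y : ℝ}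
    (h₁ : k ≤ #{i | u i ≤ y}) (h₂ : #{i | u i < y} < k) : orderStat u k = y := by
  simp [orderStat, hk, hkm, empiricalQuantile_eq_coe hm u h₁ h₂]

lemma orderStat_mem {m : ℕ} (hm : 0 < m) {u : Fin m → ℝ} (hu : ∀ i, u i ∈ Set.Icc (0 : ℝ) 1)
    (k : ℕ) : orderStat u k ∈ Set.Icc (0 : ℝ) 1 := by
  rcases eq_or_ne k 0 with rfl | hk
  · simp
  rcases lt_or_ge m k with hkm | hkm
  · simp [orderStat_of_lt u hkm]
  obtain ⟨j, h₁, h₂⟩ := exists_kth_smallest u hk hkm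
  rw [orderStat_eq hm u hk hkm h₁ h₂]
  exact hu j

-- Turns order statistics into counts. The bounds on x are forced by the conventions at the ends:
-- the value 0 at index 0 and the value 1 beyond m.
open Finset in
lemma orderStat_le_iff {m : ℕ} (hm : 0 < m) (u : Fin m → ℝ) (k : ℕ) {x : ℝ} (hx : 0 ≤ x)
    (hx1 : x < 1) : orderStat u k ≤ x ↔ k ≤ #{i | u i ≤ x} := by
  rcases eq_or_ne k 0 with rfl | hk
  · simpa
  rcases lt_or_ge m k with hkm | hkm
  · have := card_le_univ ({i | u i ≤ x} : Finset (Fin m))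
    simp only [Fintype.card_fin] at this
    rw [orderStat_of_lt u hkm]
    exact ⟨fun h => absurd h (not_le.2 hx1), fun h => by omega⟩
  obtain ⟨j, h₁, h₂⟩ := exists_kth_smallest u hk hkm
  rw [orderStat_eq hm u hk hkm h₁ h₂]
  constructor
  · intro h
    refine h₁.trans (card_le_card fun i hi => ?_)
    simp only [mem_filter, mem_univ, true_and] at hi ⊢
    exact hi.trans h
  · intro h
    by_contra! hlt
    refine absurd (h.trans (card_le_card fun i hi => ?_)) (not_le.2 h₂)
    simp only [mem_filter, mem_univ, true_and] at hi ⊢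
    exact hi.trans_lt hlt

open Finset in
lemma measurableSet_le_card {m : ℕ} (k : ℕ) (x : ℝ) :
    MeasurableSet {u : Fin m → ℝ | k ≤ #{i | u i ≤ x}} := by
  have : Measurable fun u : Fin m → ℝ => #{i | u i ≤ x} := by
    simp only [card_filter]
    exact Finset.measurable_fun_sum _ fun i _ => Measurable.ite
      (measurableSet_le (measurable_pi_apply i) measurable_const) measurable_const measurable_const
  exact measurableSet_le measurable_const this

open Finset in
lemma measurable_empiricalQuantile {m : ℕ} (hm : 0 < m) (k : ℕ) :
    Measurable fun v : Fin m → ℝ => empiricalQuantile v ((k : ℝ) / m) := by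
  rcases eq_or_ne k 0 with rfl | hk
  · simp only [empiricalQuantile_zero, measurable_const]
  rcases lt_or_ge m k with hkm | hkm
  · simp only [empiricalQuantile_of_lt hm _ hkm, measurable_const]
  refine measurable_of_Iic fun c => ?_
  have key : ∀ v : Fin m → ℝ, ∃ y : ℝ, empiricalQuantile v ((k : ℝ) / m) = y ∧
      k ≤ #{i | v i ≤ y} ∧ #{i | v i < y} < k := fun v => by
    obtain ⟨j, h₁, h₂⟩ := exists_kth_smallest v hk hkm
    exact ⟨v j, empiricalQuantile_eq_coe hm v h₁ h₂, h₁, h₂⟩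
  induction c with
  | bot =>
    convert! MeasurableSet.empty
    ext v
    obtain ⟨y, hy, -⟩ := key v
    simp [hy]
  | top => simp
  | coe x =>
    convert! measurableSet_le_card k x using 1
    ext v
    obtain ⟨y, hy, h₁, h₂⟩ := key v
    simp only [Set.mem_preimage, Set.mem_Iic, hy, EReal.coe_le_coe_iff, Set.mem_ofPred_eq]
    constructor
    · intro h
      refine h₁.trans (card_le_card fun i hi => ?_)
      simp only [mem_filter, mem_univ, true_and] at hi ⊢
      exact hi.trans h
    · intro h
      by_contra! hlt
      refine absurd (h.trans (card_le_card fun i hi => ?_)) (not_le.2 h₂)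
      simp only [mem_filter, mem_univ, true_and] at hi ⊢
      exact hi.trans_lt hlt

lemma measurable_orderStat {m : ℕ} (hm : 0 < m) (k : ℕ) :
    Measurable fun u : Fin m → ℝ => orderStat u k := by
  unfold orderStat
  split_ifs
  · exact measurable_const
  · exact measurable_const
  · exact (measurable_empiricalQuantile hm k).ereal_toReal

/-! ### Shift invariance of uniform spacings -/

/-- The affine map `w` with `w i = u i - u j` for `i ≠ j` and `w j = 1 - u j`. On the part of the
unit cube where `u j` is minimal it rotates the spacings of `u`. -/
def spacingRotation {m : ℕ} (j : Fin m) (u : Fin m → ℝ) : Fin m → ℝ :=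
  fun i => if i = j then 1 - u j else u i - u j

/-- The linear part is an involution, so its determinant is ±1; the rest is a translation by a basis
vector. -/
lemma measurePreserving_spacingRotation {m : ℕ} (j : Fin m) :
    MeasurePreserving (spacingRotation j) (volume : Measure (Fin m → ℝ)) volume := by
  let T : (Fin m → ℝ) →ₗ[ℝ] (Fin m → ℝ) :=
    { toFun := fun u i => if i = j then -u j else u i - u j
      map_add' := fun u v => by
        ext i; simp only [Pi.add_apply]; split_ifs <;> ring
      map_smul' := fun c u => by
        ext i; simp only [Pi.smul_apply, smul_eq_mul, RingHom.id_apply]; split_ifs <;> ring }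
  have hTT : T ∘ₗ T = LinearMap.id := by
    refine LinearMap.ext fun u => funext fun i => ?_
    by_cases h : i = j <;> simp [T, h]
  have hdet : LinearMap.det T * LinearMap.det T = 1 := by
    rw [← LinearMap.det_comp, hTT, LinearMap.det_id]
  have hne : LinearMap.det T ≠ 0 := fun h => by simp [h] at hdet
  have habs : |(LinearMap.det T)⁻¹| = 1 := by
    rcases mul_self_eq_one_iff.1 hdet with h | h <;> simp [h]
  have hT : MeasurePreserving T (volume : Measure (Fin m → ℝ)) volume := by
    refine ⟨T.continuous_of_finiteDimensional.measurable, ?_⟩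
    rw [Measure.map_linearMap_addHaar_eq_smul_addHaar _ hne, habs]
    simp
  have h := (measurePreserving_add_left (volume : Measure (Fin m → ℝ)) (Pi.single j 1)).comp hT
  convert! h using 1
  ext u i
  by_cases hi : i = j
  · subst hi; simp [spacingRotation, T]; ring
  · simp [spacingRotation, T, hi]

-- Subtracting the minimum lowers every rank by one, and the freed coordinate j becomes the new
-- maximum 1 - u j. At k = m it matches the convention that the order statistic of index m + 1 is 1.
open Finset in
lemma orderStat_spacingRotation {m : ℕ} (hm : 0 < m) {j : Fin m} {u : Fin m → ℝ}
    (hu : ∀ i, u i ∈ Set.Ioo (0 : ℝ) 1) (hj : ∀ i, u j ≤ u i) {k : ℕ} (hk : k ≤ m) :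
    orderStat (spacingRotation j u) k = orderStat u (k + 1) - u j := by
  have hu' : ∀ i, u i ∈ Set.Icc (0 : ℝ) 1 := fun i => Set.Ioo_subset_Icc_self (hu i)
  have hw : ∀ i, spacingRotation j u i ∈ Set.Icc (0 : ℝ) (1 - u j) := by
    intro i
    have h1 := hj i
    have h2 := hu i
    have h3 := hu j
    simp only [spacingRotation, Set.mem_Icc, Set.mem_Ioo] at *
    split_ifs <;> constructor <;> linarith
  have hj0 := hu j
  have hw' : ∀ i, spacingRotation j u i ∈ Set.Icc (0 : ℝ) 1 := fun i =>
    ⟨(hw i).1, (hw i).2.trans (by linarith [hj0.1])⟩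
  refine eq_of_forall_ge_iff fun x => ?_
  rw [sub_le_iff_le_add]
  have m1 := orderStat_mem hm hw' k
  have m2 := orderStat_mem hm hu' (k + 1)
  rcases lt_or_ge x 0 with hx0 | hx0
  · refine iff_of_false (by linarith [m1.1]) fun h => ?_
    have hz : 0 ≤ x + u j := m2.1.trans h
    rw [orderStat_le_iff hm u _ hz (by linarith [hj0.2])] at h
    have : #{i | u i ≤ x + u j} = 0 := by
      rw [card_eq_zero, filter_eq_empty_iff]
      intro i _
      linarith [hj i]
    omega
  rcases le_or_gt 1 x with hx1 | hx1
  · exact iff_of_true (by linarith [m1.2]) (by linarith [m2.2, hj0.1])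
  rw [orderStat_le_iff hm _ _ hx0 hx1]
  rcases le_or_gt 1 (x + u j) with hx2 | hx2
  · refine iff_of_true ?_ (by linarith [m2.2])
    have : ({i | spacingRotation j u i ≤ x} : Finset (Fin m)) = univ := by
      ext i
      simp only [mem_filter, mem_univ, true_and, iff_true]
      linarith [(hw i).2]
    rw [this]
    simpa
  rw [orderStat_le_iff hm _ _ (by linarith [hj0.1]) hx2]
  -- The index j is counted for u because x ≥ 0, but not for the rotated point because x + u j < 1;
  -- this is the shift by one.
  have : (univ.filter fun i => u i ≤ x + u j) =
      insert j (univ.filter fun i => spacingRotation j u i ≤ x) := by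
    ext i
    simp only [mem_filter, mem_univ, true_and, mem_insert]
    simp only [spacingRotation]
    by_cases hi : i = j
    · subst hi; simp [hx0]
    · simp [hi]
  rw [this, card_insert_of_notMem]
  · simp
  · simp only [mem_filter, mem_univ, true_and]
    simp only [spacingRotation, if_true]
    linarith

/-- Each coincidence of two coordinates is the kernel of a nonzero linear form, hence null. -/
lemma ae_injective_volume {m : ℕ} :
    ∀ᵐ u ∂(volume : Measure (Fin m → ℝ)), Function.Injective u := by
  have : ∀ᵐ u ∂(volume : Measure (Fin m → ℝ)), ∀ i j, i ≠ j → u i ≠ u j := by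
    refine ae_all_iff.2 fun i => ae_all_iff.2 fun j => ?_
    rcases eq_or_ne i j with rfl | hij
    · simp
    let f : (Fin m → ℝ) →ₗ[ℝ] ℝ :=
      LinearMap.proj (R := ℝ) (φ := fun _ => ℝ) i - LinearMap.proj (R := ℝ) (φ := fun _ => ℝ) j
    have hne : LinearMap.ker f ≠ ⊤ := by
      intro h
      have h1 : Pi.single i (1 : ℝ) ∈ LinearMap.ker f := h ▸ Submodule.mem_top
      simp [f, hij] at h1
    have h0 := Measure.addHaar_submodule (volume : Measure (Fin m → ℝ)) _ hne
    filter_upwards [measure_eq_zero_iff_ae_notMem.1 h0] with u hu _ h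
    exact hu (by simp [f, h])
  filter_upwards [this] with u hu i j h
  by_contra hij
  exact hu i j hij h

/-- Lebesgue measure on the open unit cube, i.e. the joint law of `m` independent uniforms. -/
noncomputable def uniformCube (m : ℕ) : Measure (Fin m → ℝ) :=
  volume.restrict (Set.univ.pi fun _ => Set.Ioo 0 1)

lemma uniformCube_eq_pi (m : ℕ) :
    uniformCube m = Measure.pi fun _ => (volume : Measure ℝ).restrict (Set.Ioo 0 1) := by
  rw [uniformCube, volume_pi, Measure.restrict_pi_pi]

instance (m : ℕ) : IsProbabilityMeasure (uniformCube m) := by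
  have : IsProbabilityMeasure ((volume : Measure ℝ).restrict (Set.Ioo 0 1)) := ⟨by simp⟩
  rw [uniformCube_eq_pi]
  infer_instance

lemma ae_uniformCube_mem (m : ℕ) : ∀ᵐ u ∂uniformCube m, ∀ i, u i ∈ Set.Ioo (0 : ℝ) 1 := by
  filter_upwards [ae_restrict_mem (MeasurableSet.univ_pi fun _ => measurableSet_Ioo)] with u hu i
  exact hu i trivial

lemma measurableSet_strict_extremum {m : ℕ} (j : Fin m) (r : ℝ → ℝ → Prop)
    (hr : MeasurableSet {p : ℝ × ℝ | r p.1 p.2}) :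
    MeasurableSet {u : Fin m → ℝ | (∀ i, u i ∈ Set.Ioo (0 : ℝ) 1) ∧ ∀ i ≠ j, r (u j) (u i)} := by
  simp only [Set.ofPred_and, Set.ofPred_forall]
  refine (MeasurableSet.iInter fun i => measurable_pi_apply i measurableSet_Ioo).inter
    (MeasurableSet.iInter fun i => MeasurableSet.iInter fun _ => ?_)
  have hp : Measurable fun u : Fin m → ℝ => (u j, u i) := by fun_prop
  exact hp hr

/-- Splitting of the unit cube according to the coordinate which is extremal. -/
lemma uniformCube_apply_eq_sum {m : ℕ} (r : ℝ → ℝ → Prop)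
    (hr : MeasurableSet {p : ℝ × ℝ | r p.1 p.2}) (hasymm : ∀ x y, r x y → ¬ r y x)
    (hex : ∀ u : Fin m → ℝ, Function.Injective u → ∃ j, ∀ i ≠ j, r (u j) (u i))
    {E : Set (Fin m → ℝ)} (hE : MeasurableSet E) :
    uniformCube m E = ∑ j, volume
      ({u : Fin m → ℝ | (∀ i, u i ∈ Set.Ioo (0 : ℝ) 1) ∧ ∀ i ≠ j, r (u j) (u i)} ∩ E) := by
  rw [← measure_biUnion_finset, uniformCube, Measure.restrict_apply hE]
  -- The pieces cover the cube up to points with ties, which are null.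
  · refine measure_congr ?_
    filter_upwards [ae_injective_volume] with u hu
    refine propext ?_
    change (u ∈ E ∧ u ∈ Set.univ.pi _) ↔ u ∈ (⋃ j ∈ Finset.univ, _ : Set (Fin m → ℝ))
    obtain ⟨j, hj⟩ := hex u hu
    simp only [Set.mem_pi, Set.mem_univ, true_imp_iff, Set.mem_iUnion, Set.mem_inter_iff,
      Set.mem_ofPred_eq, Finset.mem_univ, exists_prop, true_and]
    exact ⟨fun h => ⟨j, ⟨h.2, hj⟩, h.1⟩, fun ⟨_, h, hE⟩ => ⟨hE, h.1⟩⟩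
  · intro i _ j _ hij
    rw [Function.onFun, Set.disjoint_left]
    rintro u ⟨⟨-, h1⟩, -⟩ ⟨⟨-, h2⟩, -⟩
    exact hasymm _ _ (h1 j hij.symm) (h2 i hij)
  · exact fun j _ => (measurableSet_strict_extremum j r hr).inter hE

/-- The spacings of uniform order statistics are invariant under an index shift. -/
lemma map_orderStat_sub_succ {m : ℕ} (hm : 0 < m) {a b : ℕ} (ha : a ≤ m) (hb : b ≤ m) :
    (uniformCube m).map (fun u => orderStat u (b + 1) - orderStat u (a + 1)) =
      (uniformCube m).map (fun u => orderStat u b - orderStat u a) := by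
  have hmeas : ∀ a b, Measurable fun u : Fin m → ℝ => orderStat u b - orderStat u a :=
    fun a b => (measurable_orderStat hm b).sub (measurable_orderStat hm a)
  have : Nonempty (Fin m) := ⟨⟨0, hm⟩⟩
  ext S hS
  rw [Measure.map_apply (hmeas _ _) hS, Measure.map_apply (hmeas _ _) hS,
    uniformCube_apply_eq_sum (· < ·) measurableSet_lt' (fun x y h => h.not_gt) ?_
      (hmeas _ _ hS),
    uniformCube_apply_eq_sum (· > ·) (measurableSet_lt measurable_snd measurable_fst)
      (fun x y h => h.not_gt) ?_ (hmeas _ _ hS)]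
  · refine Finset.sum_congr rfl fun j _ => ?_
    -- The rotation pulls the piece with maximal coordinate j back to the piece with minimal
    -- coordinate j; there the subtracted u j cancels in the difference.
    rw [← (measurePreserving_spacingRotation j).measure_preimage
      ((measurableSet_strict_extremum j (· > ·)
        (measurableSet_lt measurable_snd measurable_fst)).inter
        (hmeas _ _ hS)).nullMeasurableSet]
    congr 1
    ext u
    have hiff : ((∀ i, u i ∈ Set.Ioo (0 : ℝ) 1) ∧ ∀ i ≠ j, u j < u i) ↔
        ((∀ i, spacingRotation j u i ∈ Set.Ioo (0 : ℝ) 1) ∧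
          ∀ i ≠ j, spacingRotation j u j > spacingRotation j u i) := by
      simp only [spacingRotation, if_true, Set.mem_Ioo]
      constructor
      · rintro ⟨h1, h2⟩
        refine ⟨fun i => ?_, fun i hi => ?_⟩
        · have := h1 i
          have := h1 j
          by_cases hi : i = j
          · simp only [hi, if_true]; constructor <;> linarith
          · have := h2 i hi
            simp only [hi, if_false]; constructor <;> linarith
        · simp only [hi, if_false]; linarith [(h1 i).2]
      · rintro ⟨h1, h2⟩
        have hj := h1 j
        simp only [if_true] at hj
        have key : ∀ i ≠ j, u j < u i ∧ u i < 1 := fun i hi => by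
          have h3 := h1 i
          have h4 := h2 i hi
          simp only [hi, if_false] at h3 h4
          constructor <;> linarith
        refine ⟨fun i => ?_, fun i hi => (key i hi).1⟩
        by_cases hi : i = j
        · rw [hi]; constructor <;> linarith
        · have := key i hi
          constructor <;> linarith
    simp only [Set.mem_inter_iff, Set.mem_preimage, Set.mem_ofPred_eq, ← hiff]
    refine and_congr_right fun h => ?_
    have hj : ∀ i, u j ≤ u i := fun i => by
      by_cases hi : i = j
      · rw [hi]
      · exact (h.2 i hi).le
    rw [orderStat_spacingRotation hm h.1 hj ha, orderStat_spacingRotation hm h.1 hj hb,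
      sub_sub_sub_cancel_right]
  · intro u hu
    obtain ⟨j, hj⟩ := Finite.exists_max u
    exact ⟨j, fun i hi => lt_of_le_of_ne (hj i) fun h => hi (hu h)⟩
  · intro u hu
    obtain ⟨j, hj⟩ := Finite.exists_min u
    exact ⟨j, fun i hi => lt_of_le_of_ne (hj i) fun h => hi (hu h).symm⟩

lemma map_orderStat_sub {m : ℕ} (hm : 0 < m) (a l : ℕ) (h : a + l ≤ m + 1) :
    (uniformCube m).map (fun u => orderStat u (a + l) - orderStat u a) =
      (uniformCube m).map (fun u => orderStat u l) := by
  induction a with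
  | zero => simp
  | succ a ih =>
    rw [← ih (by omega), ← map_orderStat_sub_succ hm (a := a) (b := a + l) (by omega) (by omega)]
    simp only [add_right_comm]

/-! ### The Beta law of a uniform order statistic -/

open Finset in
lemma uniformCube_real_filter_eq {m : ℕ} {x : ℝ} (hx : x ∈ Set.Icc (0 : ℝ) 1) (S : Finset (Fin m)) :
    (uniformCube m).real {u | ({i | u i ≤ x} : Finset (Fin m)) = S} =
      x ^ #S * (1 - x) ^ (m - #S) := by
  have hset : {u : Fin m → ℝ | ({i | u i ≤ x} : Finset (Fin m)) = S} =
      Set.univ.pi fun i => if i ∈ S then Set.Iic x else Set.Ioi x := by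
    ext u
    simp only [Set.mem_ofPred_eq, Finset.ext_iff, mem_filter, mem_univ, true_and, Set.mem_pi,
      Set.mem_univ, true_imp_iff]
    refine forall_congr' fun i => ?_
    by_cases h : i ∈ S <;> simp [h]
  have h1 : (volume : Measure ℝ).restrict (Set.Ioo 0 1) (Set.Iic x) = ENNReal.ofReal x := by
    rw [Measure.restrict_congr_set Ioo_ae_eq_Ioc, Measure.restrict_apply measurableSet_Iic,
      Set.inter_comm, Set.Ioc_inter_Iic, min_eq_right hx.2]
    simp
  have h2 : (volume : Measure ℝ).restrict (Set.Ioo 0 1) (Set.Ioi x) = ENNReal.ofReal (1 - x) := by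
    rw [Measure.restrict_apply measurableSet_Ioi, Set.inter_comm, Set.Ioo_inter_Ioi,
      max_eq_right hx.1]
    simp
  rw [hset, uniformCube_eq_pi, measureReal_def, Measure.pi_pi]
  have : ∀ i, (volume : Measure ℝ).restrict (Set.Ioo 0 1)
      (if i ∈ S then Set.Iic x else Set.Ioi x) = ENNReal.ofReal (if i ∈ S then x else 1 - x) := by
    intro i
    split_ifs <;> assumption
  rw [prod_congr rfl fun i _ => this i, ENNReal.toReal_prod,
    prod_congr rfl fun i _ => ENNReal.toReal_ofReal (show 0 ≤ if i ∈ S then x else 1 - x by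
      split_ifs; exacts [hx.1, sub_nonneg.2 hx.2]), prod_ite]
  simp only [prod_const, filter_mem_eq_inter, univ_inter]
  congr 2
  rw [filter_not, filter_mem_eq_inter, univ_inter, ← compl_eq_univ_sdiff, card_compl,
    Fintype.card_fin]

-- Splitting by the set of coordinates that are at most x and grouping by its size gives a binomial
-- tail.
open Finset in
lemma uniformCube_real_le_card {m : ℕ} {x : ℝ} (hx : x ∈ Set.Icc (0 : ℝ) 1) (l : ℕ) :
    (uniformCube m).real {u | l ≤ #{i | u i ≤ x}} =
      ∑ k ∈ Ico l (m + 1), (bernsteinPolynomial ℝ m k).eval x := by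
  have hset : {u : Fin m → ℝ | l ≤ #{i | u i ≤ x}} =
      ⋃ S ∈ (univ : Finset (Fin m)).powerset.filter (fun S => l ≤ #S),
        {u | ({i | u i ≤ x} : Finset (Fin m)) = S} := by
    ext u; simp
  have hmeas (S : Finset (Fin m)) :
      MeasurableSet {u : Fin m → ℝ | ({i | u i ≤ x} : Finset (Fin m)) = S} := by
    simp only [Finset.ext_iff, mem_filter, mem_univ, true_and, Set.ofPred_forall]
    refine MeasurableSet.iInter fun i => ?_
    by_cases h : i ∈ S
    · simpa [h] using measurableSet_le (measurable_pi_apply i) measurable_const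
    · simpa [h] using measurableSet_lt measurable_const (measurable_pi_apply i)
  rw [hset, measureReal_biUnion_finset _ (fun S _ => hmeas S), sum_filter,
    sum_congr rfl fun S _ => by rw [uniformCube_real_filter_eq hx S],
    sum_powerset_apply_card (fun c => if l ≤ c then x ^ c * (1 - x) ^ (m - c) else 0)]
  · simp only [card_univ, Fintype.card_fin, smul_ite, smul_zero, ← sum_filter]
    refine sum_congr (by ext; simp; omega) fun k _ => ?_
    simp [bernsteinPolynomial, mul_assoc]
  · intro S _ T _ hST
    exact Set.disjoint_left.2 fun u h1 h2 => hST (h1.symm.trans h2)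

-- Each derivative is a multiple of a difference of consecutive Bernstein polynomials of degree n;
-- the sum telescopes and its upper end vanishes.
open Finset Polynomial in
lemma derivative_sum_bernsteinPolynomial {n a : ℕ} (ha : a ≤ n) :
    derivative (∑ k ∈ Ico (a + 1) (n + 2), bernsteinPolynomial ℝ (n + 1) k) =
      (n + 1 : ℝ[X]) * bernsteinPolynomial ℝ n a := by
  rw [sum_Ico_eq_sum_range, derivative_sum,
    sum_congr rfl fun i _ => by
      rw [add_right_comm, bernsteinPolynomial.derivative_succ_aux], ← mul_sum,
    sum_congr rfl fun i _ => by rw [add_assoc],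
    sum_range_sub' (fun i => bernsteinPolynomial ℝ n (a + i)),
    bernsteinPolynomial.eq_zero_of_lt ℝ (show n < a + (n + 2 - (a + 1)) by omega)]
  simp

lemma betaPDF_eq_bernsteinPolynomial {n a : ℕ} (ha : a ≤ n) {x : ℝ} (hx : x ∈ Set.Ioo (0 : ℝ) 1) :
    betaPDF ((a : ℝ) + 1) ((n - a : ℕ) + 1) x =
      ENNReal.ofReal (((n : ℝ) + 1) * (bernsteinPolynomial ℝ n a).eval x) := by
  rw [betaPDF_of_pos_lt_one hx.1 hx.2, beta]
  have e : (a : ℝ) + 1 + ((n - a : ℕ) + 1) = ((n + 1 : ℕ) : ℝ) + 1 := by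
    rw [Nat.cast_sub ha]; push_cast; ring
  rw [e]
  simp only [Real.Gamma_nat_eq_factorial, add_sub_cancel_right, Real.rpow_natCast]
  congr 1
  simp only [bernsteinPolynomial, Polynomial.eval_mul, Polynomial.eval_natCast,
    Polynomial.eval_pow, Polynomial.eval_X, Polynomial.eval_sub, Polynomial.eval_one]
  rw [Nat.cast_choose ℝ ha, Nat.factorial_succ]
  push_cast
  field_simp

-- The right-hand polynomial vanishes at 0 and its derivative is the Beta density on (0, 1), so the
-- fundamental theorem of calculus applies. It is used with a = l - 1 and n = m - 1.
open Finset in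
lemma betaMeasure_Iic {n a : ℕ} (ha : a ≤ n) {x : ℝ} (hx : x ∈ Set.Icc (0 : ℝ) 1) :
    betaMeasure ((a : ℝ) + 1) ((n - a : ℕ) + 1) (Set.Iic x) =
      ENNReal.ofReal
        (∑ k ∈ Ico (a + 1) (n + 2), (bernsteinPolynomial ℝ (n + 1) k).eval x) := by
  set p := ∑ k ∈ Ico (a + 1) (n + 2), bernsteinPolynomial ℝ (n + 1) k with hp
  set q : ℝ → ℝ := fun t => ((n : ℝ) + 1) * (bernsteinPolynomial ℝ n a).eval t with hq
  have hqc : Continuous q := continuous_const.mul (Polynomial.continuous _)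
  have hderiv : ∀ t, HasDerivAt (fun t => p.eval t) (q t) t := fun t => by
    have := p.hasDerivAt t
    rw [hp, derivative_sum_bernsteinPolynomial ha] at this
    simpa [hq, hp] using this
  have h0 : p.eval 0 = 0 := by
    rw [hp, Polynomial.eval_finsetSum]
    refine sum_eq_zero fun k hk => ?_
    have := (mem_Ico.1 hk).1
    rw [bernsteinPolynomial.eval_at_0, if_neg (by omega)]
  have hint : ∫ t in (0 : ℝ)..x, q t = p.eval x := by
    rw [intervalIntegral.integral_eq_sub_of_hasDerivAt (fun t _ => hderiv t)
      (hqc.intervalIntegrable _ _), h0, sub_zero]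
  rw [← Polynomial.eval_finsetSum, ← hp, ← hint, intervalIntegral.integral_of_le hx.1,
    ofReal_integral_eq_lintegral_ofReal hqc.integrableOn_Ioc, betaMeasure,
    withDensity_apply _ measurableSet_Iic]
  · rw [← setLIntegral_congr (Ioo_ae_eq_Ioc (a := (0 : ℝ)) (b := x)),
      ← setLIntegral_congr (Iio_ae_eq_Iic (a := x)),
      ← lintegral_indicator measurableSet_Iio, ← lintegral_indicator measurableSet_Ioo]
    congr 1
    ext t
    simp only [Set.indicator, Set.mem_Iio, Set.mem_Ioo]
    by_cases h1 : t < x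
    · by_cases h2 : 0 < t
      · rw [if_pos h1, if_pos ⟨h2, h1⟩,
          betaPDF_eq_bernsteinPolynomial ha ⟨h2, h1.trans_le hx.2⟩]
      · rw [if_pos h1, if_neg (by tauto), betaPDF_eq_zero_of_nonpos (not_lt.1 h2)]
    · rw [if_neg h1, if_neg (by tauto)]
  · refine (ae_restrict_iff' measurableSet_Ioc).2 (.of_forall fun t ht => ?_)
    have : 0 ≤ 1 - t := by linarith [ht.2, hx.2]
    have := ht.1.le
    simp only [hq, bernsteinPolynomial, Polynomial.eval_mul, Polynomial.eval_natCast,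
      Polynomial.eval_pow, Polynomial.eval_X, Polynomial.eval_sub, Polynomial.eval_one,
      Pi.zero_apply]
    positivity

/-- The `l`-th order statistic of `m` independent uniforms has law `Beta(l, m - l + 1)`. -/
lemma map_orderStat_eq_betaMeasure {m l : ℕ} (hl : l ≠ 0) (hlm : l ≤ m) :
    (uniformCube m).map (fun u => orderStat u l) = betaMeasure l ((m : ℝ) - l + 1) := by
  obtain ⟨a, rfl⟩ := Nat.exists_eq_succ_of_ne_zero hl
  obtain ⟨n, rfl⟩ : ∃ n, m = n + 1 := ⟨m - 1, by omega⟩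
  have ha : a ≤ n := by omega
  have hm : 0 < n + 1 := n.succ_pos
  have e1 : ((a.succ : ℕ) : ℝ) = a + 1 := by push_cast; ring
  have e2 : ((n + 1 : ℕ) : ℝ) - (a + 1) + 1 = (n - a : ℕ) + 1 := by
    rw [Nat.cast_sub ha]; push_cast; ring
  rw [e1, e2]
  have hmeas := measurable_orderStat (m := n + 1) hm (a + 1)
  have hprob : IsProbabilityMeasure (betaMeasure ((a : ℝ) + 1) ((n - a : ℕ) + 1)) :=
    isProbabilityMeasureBeta (by positivity) (by positivity)
  have hprob' : IsProbabilityMeasure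
      ((uniformCube (n + 1)).map (fun u => orderStat u (a + 1))) :=
    Measure.isProbabilityMeasure_map hmeas.aemeasurable
  have hone : betaMeasure ((a : ℝ) + 1) ((n - a : ℕ) + 1) (Set.Iic 1) = 1 := by
    rw [betaMeasure_Iic ha (by simp), Finset.sum_eq_single (n + 1)]
    · simp [bernsteinPolynomial.eval_at_1]
    · intro k _ hk
      simp [bernsteinPolynomial.eval_at_1, hk]
    · intro h
      simp only [Finset.mem_Ico, not_and, not_lt] at h
      omega
  refine Measure.ext_of_Iic _ _ fun x => ?_
  rw [Measure.map_apply hmeas measurableSet_Iic]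
  have hmem : ∀ᵐ u ∂uniformCube (n + 1), orderStat u (a + 1) ∈ Set.Icc (0 : ℝ) 1 := by
    filter_upwards [ae_uniformCube_mem (n + 1)] with u hu
    exact orderStat_mem hm (fun i => Set.Ioo_subset_Icc_self (hu i)) _
  rcases lt_or_ge x 0 with hx0 | hx0
  · have h1 : betaMeasure ((a : ℝ) + 1) ((n - a : ℕ) + 1) (Set.Iic x) = 0 := by
      refine measure_mono_null (Set.Iic_subset_Iic.2 hx0.le) ?_
      rw [betaMeasure_Iic ha (by simp), Finset.sum_eq_zero, ENNReal.ofReal_zero]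
      intro k hk
      have := (Finset.mem_Ico.1 hk).1
      rw [bernsteinPolynomial.eval_at_0, if_neg (by omega)]
    rw [h1, measure_eq_zero_iff_ae_notMem]
    filter_upwards [hmem] with u hu h
    exact absurd (hu.1.trans h) (not_le.2 hx0)
  rcases le_or_gt 1 x with hx1 | hx1
  · have h1 : betaMeasure ((a : ℝ) + 1) ((n - a : ℕ) + 1) (Set.Iic x) = 1 :=
      le_antisymm prob_le_one (hone ▸ measure_mono (Set.Iic_subset_Iic.2 hx1))
    rw [h1, prob_compl_eq_zero_iff₀ (hmeas measurableSet_Iic).nullMeasurableSet |>.symm,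
      measure_eq_zero_iff_ae_notMem]
    filter_upwards [hmem] with u hu h
    exact h (hu.2.trans hx1)
  · rw [betaMeasure_Iic ha ⟨hx0, hx1.le⟩, ← uniformCube_real_le_card ⟨hx0, hx1.le⟩,
      ofReal_measureReal]
    congr 1
    ext u
    exact orderStat_le_iff hm u _ hx0 hx1

/-! ### Reduction to uniform variables -/

lemma continuous_cdf_of_noAtoms (ν : Measure ℝ) [IsProbabilityMeasure ν] [NullSingletonClass ν] :
    Continuous (cdf ν) := by
  refine continuous_iff_continuousAt.2 fun x => ?_
  rw [(monotone_cdf ν).continuousAt_iff_leftLim_eq_rightLim]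
  have h := (cdf ν).measure_singleton x
  rw [measure_cdf, measure_singleton, eq_comm, ENNReal.ofReal_eq_zero, sub_nonpos] at h
  rw [StieltjesFunction.rightLim_eq]
  exact le_antisymm ((monotone_cdf ν).leftLim_le le_rfl) h

/-- The probability integral transform. -/
lemma map_cdf_eq_uniform (ν : Measure ℝ) [IsProbabilityMeasure ν] [NullSingletonClass ν] :
    ν.map (cdf ν) = volume.restrict (Set.Ioo 0 1) := by
  have hc := continuous_cdf_of_noAtoms ν
  have hrange : ∀ y ∈ Set.Ioo (0 : ℝ) 1, ∃ t, cdf ν t = y := fun y hy => by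
    obtain ⟨s, hs⟩ := ((tendsto_cdf_atBot ν).eventually (gt_mem_nhds hy.1)).exists
    obtain ⟨t, ht⟩ := ((tendsto_cdf_atTop ν).eventually (lt_mem_nhds hy.2)).exists
    exact mem_range_of_exists_le_of_exists_ge hc ⟨s, hs.le⟩ ⟨t, ht.le⟩
  -- The distribution function may have flat parts, so a preimage t of y gives only one inequality
  -- for each kind of half-line.
  have hlower : ∀ y ∈ Set.Ioo (0 : ℝ) 1, ENNReal.ofReal y ≤ ν (cdf ν ⁻¹' Set.Iic y) := by
    intro y hy
    obtain ⟨t, ht⟩ := hrange y hy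
    rw [← ht, ofReal_cdf]
    exact measure_mono fun s hs => monotone_cdf ν hs
  have hupper : ∀ y ∈ Set.Ioo (0 : ℝ) 1, ν (cdf ν ⁻¹' Set.Iio y) ≤ ENNReal.ofReal y := by
    intro y hy
    obtain ⟨t, ht⟩ := hrange y hy
    rw [← ht, ofReal_cdf]
    refine measure_mono fun s hs => ?_
    by_contra hlt
    exact absurd (monotone_cdf ν (not_le.1 hlt).le) (not_le.2 hs)
  have hprob : IsProbabilityMeasure (ν.map (cdf ν)) :=
    Measure.isProbabilityMeasure_map hc.measurable.aemeasurable
  refine Measure.ext_of_Iic _ _ fun x => ?_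
  rw [Measure.map_apply hc.measurable measurableSet_Iic,
    Measure.restrict_congr_set Ioo_ae_eq_Ioc, Measure.restrict_apply measurableSet_Iic,
    Set.inter_comm, Set.Ioc_inter_Iic, Real.volume_Ioc, sub_zero]
  rcases le_or_gt 1 x with hx1 | hx1
  · have : cdf ν ⁻¹' Set.Iic x = Set.univ :=
      Set.eq_univ_of_forall fun t => (cdf_le_one ν t).trans hx1
    simp [this, hx1]
  rw [min_eq_right hx1.le]
  refine le_antisymm ?_ ?_
  -- The upper bound is for open half-lines, so x is approached from the right; the maximum with 0
  -- also covers negative x.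
  · refine ENNReal.le_of_forall_pos_le_add fun ε hε _ => ?_
    have hpos : 0 ≤ max x 0 := le_max_right _ _
    obtain ⟨y, hxy, hy⟩ : ∃ y, max x 0 < y ∧ y < min 1 (max x 0 + ε) :=
      exists_between (lt_min (max_lt hx1 one_pos) (by simpa using hε))
    rw [lt_min_iff] at hy
    calc ν (cdf ν ⁻¹' Set.Iic x) ≤ ν (cdf ν ⁻¹' Set.Iio y) :=
          measure_mono fun t ht => ((show cdf ν t ≤ x from ht).trans (le_max_left _ _)).trans_lt hxy
      _ ≤ ENNReal.ofReal y := hupper y ⟨hpos.trans_lt hxy, hy.1⟩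
      _ ≤ ENNReal.ofReal (max x 0 + ε) := ENNReal.ofReal_le_ofReal hy.2.le
      _ = ENNReal.ofReal x + ε := by
          rw [ENNReal.ofReal_add hpos ε.coe_nonneg, ENNReal.ofReal_coe_nnreal, ENNReal.ofReal_max]
          simp
  · rcases le_or_gt x 0 with hx0 | hx0
    · simp [ENNReal.ofReal_of_nonpos hx0]
    · exact hlower x ⟨hx0, hx1⟩

open Finset in
/-- The mass below the empirical quantile of `v` is the order statistic of the transforms of `v`. -/
lemma measureReal_le_empiricalQuantile {m : ℕ} (hm : 0 < m) (ν : Measure ℝ)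
    [IsProbabilityMeasure ν] (v : Fin m → ℝ) (k : ℕ) :
    ν.real {t : ℝ | (t : EReal) ≤ empiricalQuantile v ((k : ℝ) / m)} =
      orderStat (fun i => cdf ν (v i)) k := by
  rcases eq_or_ne k 0 with rfl | hk
  · rw [empiricalQuantile_zero]
    simp
  rcases lt_or_ge m k with hkm | hkm
  · rw [empiricalQuantile_of_lt hm v hkm, orderStat_of_lt _ hkm]
    simp
  -- Monotonicity carries both counts over to the transforms; ties created by flat parts do no harm,
  -- and atoms are allowed.
  obtain ⟨j, h₁, h₂⟩ := exists_kth_smallest v hk hkm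
  rw [empiricalQuantile_eq_coe hm v h₁ h₂, orderStat_eq hm _ hk hkm (y := cdf ν (v j)),
    cdf_eq_real]
  · simp [Set.Iic_def]
  · refine h₁.trans (card_le_card fun i hi => ?_)
    simp only [mem_filter, mem_univ, true_and] at hi ⊢
    exact monotone_cdf ν hi
  · refine (card_le_card fun i hi => ?_).trans_lt h₂
    simp only [mem_filter, mem_univ, true_and] at hi ⊢
    exact (monotone_cdf ν).reflect_lt hi

/-- The law of the mass between two order statistics of an i.i.d. sample without atoms. -/
lemma map_orderStat_sub_eq_betaLaw {m a b : ℕ} (hm : 0 < m) (hab : a ≤ b) (hb : b ≤ m + 1) :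
    (uniformCube m).map (fun u => orderStat u b - orderStat u a) =
      betaLaw ((b : ℝ) - a) ((m : ℝ) - (b - a) + 1) := by
  obtain ⟨l, rfl⟩ := Nat.exists_eq_add_of_le hab
  rw [map_orderStat_sub hm a l hb, betaLaw]
  have e : ((a + l : ℕ) : ℝ) - a = l := by push_cast; ring
  simp only [e, Nat.cast_eq_zero]
  split_ifs with h1 h2
  · simp [h1]
  -- A vanishing second parameter means l = m + 1, where the order statistic is constantly 1.
  · have : m < l := by
      have : ((l : ℕ) : ℝ) = (m + 1 : ℕ) := by push_cast; linarith
      have := Nat.cast_injective this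
      omega
    simp [orderStat_of_lt _ this]
  · refine map_orderStat_eq_betaMeasure h1 (not_lt.1 fun h => h2 ?_)
    have : l = m + 1 := by omega
    rw [this]; push_cast; ring

/-! ### Consequences of independence -/

/-- The law of a variable of which two independent copies are almost surely distinct has no
atoms. -/
lemma noAtoms_of_indepFun_of_ae_ne {Ω : Type*} [MeasurableSpace Ω] {μ : Measure Ω}
    {ν : Measure ℝ} {U V : Ω → ℝ} (hU : Measurable U) (hV : Measurable V)
    (hUν : μ.map U = ν) (hVν : μ.map V = ν) (hind : IndepFun U V μ) (hne : ∀ᵐ ω ∂μ, U ω ≠ V ω) :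
    NullSingletonClass ν := by
  refine ⟨fun t => ?_⟩
  -- Both copies equal t with probability ν{t}², which must be 0.
  have h := hind.measure_inter_preimage_eq_mul {t} {t} (measurableSet_singleton t)
    (measurableSet_singleton t)
  rw [← Measure.map_apply hU (measurableSet_singleton t),
    ← Measure.map_apply hV (measurableSet_singleton t), hUν, hVν] at h
  have h0 : μ (U ⁻¹' {t} ∩ V ⁻¹' {t}) = 0 := by
    rw [measure_eq_zero_iff_ae_notMem]
    filter_upwards [hne] with ω hω h
    exact hω (h.1.trans h.2.symm)
  rw [h0, eq_comm] at h
  exact mul_self_eq_zero.1 h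

/-- The conditional probability of an event on `(D, T)` given `D`, for `T` independent of `D`. -/
lemma condExp_indicator_ae_eq_of_indepFun {Ω 𝒟 : Type*} [MeasurableSpace Ω] [MeasurableSpace 𝒟]
    {μ : Measure Ω} [IsProbabilityMeasure μ] {D : Ω → 𝒟} {T : Ω → ℝ} (hD : Measurable D)
    (hT : Measurable T) (hind : IndepFun D T μ) {A : Set (𝒟 × ℝ)} (hA : MeasurableSet A) :
    μ⟦{ω | (D ω, T ω) ∈ A} | MeasurableSpace.comap D inferInstance⟧ =ᵐ[μ]
      fun ω => (μ.map T).real (Prod.mk (D ω) ⁻¹' A) := by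
  have hprob : IsProbabilityMeasure (μ.map T) := Measure.isProbabilityMeasure_map hT.aemeasurable
  have hf : StronglyMeasurable (A.indicator fun _ => (1 : ℝ)) :=
    stronglyMeasurable_const.indicator hA
  have hint : Integrable (fun ω => A.indicator (fun _ => (1 : ℝ)) (D ω, T ω)) μ :=
    (integrable_const (1 : ℝ)).indicator (hD.prodMk hT hA)
  have h1 := condExp_prod_ae_eq_integral_condDistrib hD hT.aemeasurable hf hint
  -- By independence the joint law is a product, so the conditional law is a constant kernel.
  have h2 : condDistrib T D μ =ᵐ[μ.map D] Kernel.const 𝒟 (μ.map T) := by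
    refine condDistrib_ae_eq_of_measure_eq_compProd_of_measurable hD hT ?_
    rw [Measure.compProd_const]
    exact (indepFun_iff_map_prod_eq_prod_map_map hD.aemeasurable hT.aemeasurable).1 hind
  refine Filter.EventuallyEq.trans (Filter.EventuallyEq.of_eq ?_) (h1.trans ?_)
  · congr 1
  · filter_upwards [ae_of_ae_map hD.aemeasurable h2] with ω hω
    rw [hω, Kernel.const_apply, ← integral_indicator_one (measurable_prodMk_left hA)]
    rfl

lemma conformalThreshold_eq {m : ℕ} (v : Fin m → ℝ) {α : ℝ} {k : ℕ}
    (hk : (k : ℤ) = ⌈((m : ℝ) + 1) * (1 - α)⌉) :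
    conformalThreshold v α = empiricalQuantile v ((k : ℝ) / m) := by
  rw [conformalThreshold, ← hk, Int.cast_natCast]

lemma empiricalQuantile_mono {m : ℕ} (v : Fin m → ℝ) {p q : ℝ} (h : p ≤ q) :
    empiricalQuantile v p ≤ empiricalQuantile v q :=
  sInf_le_sInf fun _ ht => h.trans ht

/-! ### The conditional coverage law -/

theorem proposition3
    {Ω 𝒳 𝒴 : Type*} [MeasurableSpace Ω] [MeasurableSpace 𝒳] [MeasurableSpace 𝒴]
    (μ : Measure Ω) [IsProbabilityMeasure μ]
    -- the data distribution, and a (measurable) conformal score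
    (P : Measure (𝒳 × 𝒴)) [IsProbabilityMeasure P]
    (s : 𝒳 → 𝒴 → ℝ) (hs : Measurable (fun z : 𝒳 × 𝒴 => s z.1 z.2))
    -- the calibration set: independent samples from `P`
    (m : ℕ) (hm : 0 < m)
    (Dcal : Fin m → Ω → 𝒳 × 𝒴) (hDcal_meas : ∀ i, Measurable (Dcal i))
    (hDcal_law : ∀ i, μ.map (Dcal i) = P) (hDcal_indep : iIndepFun Dcal μ)
    -- the new sample, drawn from `P` independently of the calibration set
    (X : Ω → 𝒳) (Y : Ω → 𝒴) (hX : Measurable X) (hY : Measurable Y)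
    (hXY_law : μ.map (fun ω => (X ω, Y ω)) = P)
    (hXY_indep : IndepFun (fun ω => (X ω, Y ω)) (fun ω i => Dcal i ω) μ)
    -- the calibration scores are almost surely distinct
    (hdistinct : ∀ᵐ ω ∂μ, Function.Injective (fun i => s (Dcal i ω).1 (Dcal i ω).2))
    -- a single score is always distinct: for `m = 1` ask that no score value has positive mass
    (hone : m = 1 → ∀ t : ℝ, P {z | s z.1 z.2 = t} = 0)
    (α₁ α₂ : ℝ) (hα₁ : 0 ≤ α₁) (hα : α₁ < α₂) (hα₂ : α₂ ≤ 1)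
    (l : ℤ) (hl : l = ⌈((m : ℝ) + 1) * (1 - α₁)⌉ - ⌈((m : ℝ) + 1) * (1 - α₂)⌉) :
    HasLaw
      (μ⟦{ω | Y ω ∈ twoThresholdSet s (fun i => s (Dcal i ω).1 (Dcal i ω).2) α₁ α₂ (X ω)} |
        MeasurableSpace.comap (fun ω i => Dcal i ω) inferInstance⟧)
      (betaLaw (l : ℝ) ((m : ℝ) - (l : ℝ) + 1)) μ := by
  set σ : 𝒳 × 𝒴 → ℝ := fun z => s z.1 z.2 with hσ
  set ν := P.map σ with hν
  have hνprob : IsProbabilityMeasure ν := Measure.isProbabilityMeasure_map hs.aemeasurable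
  have hVmeas : ∀ i, Measurable fun ω => σ (Dcal i ω) := fun i => hs.comp (hDcal_meas i)
  have hVlaw : ∀ i, μ.map (fun ω => σ (Dcal i ω)) = ν := fun i => by
    rw [hν, ← hDcal_law i, Measure.map_map hs (hDcal_meas i)]; rfl
  have hVindep : iIndepFun (fun i ω => σ (Dcal i ω)) μ := hDcal_indep.comp _ fun _ => hs
  have hatoms : NullSingletonClass ν := by
    rcases Nat.lt_or_ge 1 m with h1 | h1
    · have h01 : (⟨0, hm⟩ : Fin m) ≠ ⟨1, h1⟩ := by simp
      refine noAtoms_of_indepFun_of_ae_ne (hVmeas _) (hVmeas _) (hVlaw _) (hVlaw _)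
        (hVindep.indepFun h01) ?_
      filter_upwards [hdistinct] with ω hω h
      exact h01 (hω h)
    · refine ⟨fun t => ?_⟩
      rw [hν, Measure.map_apply hs (measurableSet_singleton t)]
      exact hone (by omega) t
  have hm1 : (0 : ℝ) < m + 1 := by positivity
  -- The larger level α₂ gives the smaller index a; α₂ ≤ 1 makes it nonnegative, and α₁ ≥ 0 keeps b
  -- at most m + 1.
  obtain ⟨a, ha⟩ : ∃ a : ℕ, (a : ℤ) = ⌈((m : ℝ) + 1) * (1 - α₂)⌉ :=
    ⟨_, Int.toNat_of_nonneg (Int.ceil_nonneg (mul_nonneg hm1.le (by linarith)))⟩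
  have hmono : ⌈((m : ℝ) + 1) * (1 - α₂)⌉ ≤ ⌈((m : ℝ) + 1) * (1 - α₁)⌉ :=
    Int.ceil_mono (mul_le_mul_of_nonneg_left (by linarith) hm1.le)
  obtain ⟨b, hb⟩ : ∃ b : ℕ, (b : ℤ) = ⌈((m : ℝ) + 1) * (1 - α₁)⌉ :=
    ⟨_, Int.toNat_of_nonneg (by omega)⟩
  have hab : a ≤ b := by omega
  have hbm : b ≤ m + 1 := by
    have : ⌈((m : ℝ) + 1) * (1 - α₁)⌉ ≤ ((m + 1 : ℕ) : ℤ) := by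
      rw [Int.ceil_le]
      push_cast
      nlinarith
    omega
  have hlab : (l : ℝ) = (b : ℝ) - a := by
    rw [hl, ← ha, ← hb]; push_cast; ring
  set D : Ω → Fin m → 𝒳 × 𝒴 := fun ω i => Dcal i ω with hD
  have hDmeas : Measurable D := measurable_pi_lambda _ hDcal_meas
  set T : Ω → ℝ := fun ω => σ (X ω, Y ω) with hT
  have hTmeas : Measurable T := hs.comp (hX.prodMk hY)
  have hTlaw : μ.map T = ν := by
    rw [hν, ← hXY_law, Measure.map_map hs (hX.prodMk hY)]; rfl
  have hDT : IndepFun D T μ := (hXY_indep.comp hs measurable_id).symm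
  set Q : ℕ → (Fin m → 𝒳 × 𝒴) → EReal := fun k d =>
    empiricalQuantile (fun i => σ (d i)) ((k : ℝ) / m) with hQ
  have hQmeas : ∀ k, Measurable (Q k) := fun k =>
    (measurable_empiricalQuantile hm k).comp
      (measurable_pi_lambda _ fun i => hs.comp (measurable_pi_apply i))
  set A : Set ((Fin m → 𝒳 × 𝒴) × ℝ) := {p | Q a p.1 < (p.2 : EReal) ∧ (p.2 : EReal) ≤ Q b p.1}
  have hA : MeasurableSet A :=
    (measurableSet_lt ((hQmeas a).comp measurable_fst) measurable_snd.coe_real_ereal).inter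
      (measurableSet_le measurable_snd.coe_real_ereal ((hQmeas b).comp measurable_fst))
  have hset : {ω | Y ω ∈ twoThresholdSet s (fun i => s (Dcal i ω).1 (Dcal i ω).2) α₁ α₂ (X ω)} =
      {ω | (D ω, T ω) ∈ A} := by
    ext ω
    simp only [twoThresholdSet, Set.mem_ofPred_eq, conformalThreshold_eq _ ha,
      conformalThreshold_eq _ hb]
    rfl
  -- For fixed calibration data the section of A is a half-open interval: a difference of two nested
  -- lower half-lines.
  have hsec : ∀ d, ν.real (Prod.mk d ⁻¹' A) =
      orderStat (fun i => cdf ν (σ (d i))) b - orderStat (fun i => cdf ν (σ (d i))) a := by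
    intro d
    rw [← measureReal_le_empiricalQuantile hm ν, ← measureReal_le_empiricalQuantile hm ν,
      ← measureReal_sdiff]
    · congr 1
      ext t
      exact and_comm.trans (and_congr_right fun _ => not_le.symm)
    · exact fun t ht => le_trans ht (empiricalQuantile_mono _ (by gcongr))
    · exact measurableSet_le measurable_coe_real_ereal measurable_const
  have hcond := condExp_indicator_ae_eq_of_indepFun hDmeas hTmeas hDT hA
  simp only [hTlaw, hsec] at hcond
  rw [hset]
  have hcdf : Measurable (cdf ν) := (monotone_cdf ν).measurable
  refine ⟨(stronglyMeasurable_condExp.mono hDmeas.comap_le).measurable.aemeasurable, ?_⟩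
  have hUmeas : Measurable fun ω i => cdf ν (σ (D ω i)) :=
    measurable_pi_lambda _ fun i => hcdf.comp (hVmeas i)
  have hUlaw : μ.map (fun ω i => cdf ν (σ (D ω i))) = uniformCube m := by
    have h := (hVindep.comp (fun _ => cdf ν) fun _ => hcdf).map_fun_eq_pi_map
      fun i => (hcdf.comp (hVmeas i)).aemeasurable
    rw [uniformCube_eq_pi, ← map_cdf_eq_uniform ν]
    refine Eq.trans h ?_
    congr 1
    ext1 i
    rw [← Measure.map_map hcdf (hVmeas i), hVlaw i]
  have hdiff : Measurable fun u : Fin m → ℝ => orderStat u b - orderStat u a :=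
    (measurable_orderStat hm b).sub (measurable_orderStat hm a)
  rw [Measure.map_congr hcond, hlab, ← map_orderStat_sub_eq_betaLaw hm hab hbm, ← hUlaw,
    Measure.map_map hdiff hUmeas]
  rfl
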